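/- Let $\Omega$ be a nonempty set (states), $\mathbb K$ a nonempty set of maps $z:[0,\infty)\to\Omega$ (processes), and $g:\Omega\to[0,1]$ a function such that $t\mapsto g(z(t))$ is Lebesgue measurable on $[0,\infty)$ for every $z\in\mathbb K$. Let $\mathfrak D$ be the set of all probability densities $\varrho:[0,\infty)\to[0,\infty)$, $\int_0^\infty\varrho(t)\,dt=1$. For $\varrho\in\mathfrak D$ and $T,\lambda>0$ put $$\varrho^{T}_{\rm shift}(t)=\frac{\varrho(t+T)}{\int_T^\infty\varrho(s)\,ds}\ \Big(\text{if }\int_T^\infty\varrho(s)\,ds>0\Big),\quad \varrho^\lambda_{\rm scale}(t)=\lambda\varrho(\lambda t),\quad \varpi_T(t)=\tfrac1T 1_{[0,T]}(t),\quad \pi_\lambda(t)=\lambda e^{-\lambda t}\qquad(t\ge0).$$ A density $\varrho\in\mathfrak D$ is called a power density if $\varrho(t)=(\alpha+\beta t)^{-\gamma}$ for all $t\ge 0$ with some $\alpha,\beta,\gamma>0$. A density is piecewise continuous on $(0,\infty)$ if it has finitely many discontinuities in every compact subinterval of $(0,\infty)$ and finite one-sided limits at every point of $(0,\infty)$. Let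 $A$ be a $\sigma$-algebra on $\mathbb K$ such that $z\mapsto\int_0^\infty\varrho(t)g(z(t))\,dt$ is $A$-measurable for every $\varrho\in\mathfrak D$. For each $\omega\in\Omega$ let $\mathcal L(\omega),\mathcal M(\omega)$ be nonempty sets, and to every $(l,m)\in\mathcal L(\omega)\times\mathcal M(\omega)$ let there correspond a probability measure on $(\mathbb K,A)$, with expectation $\mathbb M^\omega_{lm}$. For $\varrho\in\mathfrak D$ put $$\mathcal V[\varrho](\omega)=\sup_{l\in\mathcal L(\omega)}\inf_{m\in\mathcal M(\omega)}\mathbb M^\omega_{lm}\int_0^\infty\varrho(t)g(z(t))\,dt\qquad(\omega\in\Omega).$$ For $T>0$ consider the following assumption $(H_T)$: for every $\varrho\in\mathfrak D$ the map $\mathbb K\ni z\mapsto\mathcal V[\varrho](z(T))$ is $A$-measurable, and for all $\varrho\in\mathfrak D$, $\omega\in\Omega$ $$\mathcal V[\varrho](\omega)=\sup_{l\in\mathcal L(\omega)}\inf_{m\in\mathcal M(\omega)}\mathbb M^\omega_{lm}\Big[\int_0^T\varrho(t)g(z(t))\,dt+\sup_{l'\in\mathcal L(z(T))}\inf_{m'\in\mathcal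 M(z(T))}\mathbb M^{z(T)}_{l'm'}\int_0^\infty\varrho(t+T)g(z_1(t))\,dt\Big]$$ (where $z_1$ is the variable of the inner expectation). Suppose that at least one of the following holds: 1. $(H_T)$ holds for all real $T>0$; 2. $z(n+s)=z(n)$ for all $z\in\mathbb K$, $n\in\{0,1,2,\dots\}$, $s\in(0,1)$, and $(H_n)$ holds for all integers $n\ge1$. Then for every function $U_*:\Omega\to[0,1]$ the following five conditions are equivalent: * $(c)$ for every density $\mu\in\mathfrak D$ that is piecewise continuous on $(0,\infty)$, $\mathcal V[\mu^\lambda_{\rm scale}]\to U_*$ uniformly on $\Omega$ as $\lambda\to+0$; * $(u)$ $\mathcal V[\varpi_T]\to U_*$ uniformly on $\Omega$ as $T\to+\infty$; * $(e)$ $\mathcal V[\pi_\lambda]\to U_*$ uniformly on $\Omega$ as $\lambda\to+0$; * $(p)$ for some power density $\varrho\in\mathfrak D$, $\mathcal V[\varrho^T_{\rm shift}]\to U_*$ uniformly on $\Omega$ as $T\to+\infty$; * $(q)$ for every power density $\varrho\in\mathfrak D$, $\mathcal V[\varrho^T_{\rm shift}]\to U_*$ uniformly on $\Omega$ as $T\to+\infty$.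 In particular, if one of the limits $\lim_{T\to+\infty}\mathcal V[\varpi_T]$, $\lim_{\lambda\to+0}\mathcal V[\pi_\lambda]$, $\lim_{T\to+\infty}\mathcal V[\varrho^T_{\rm shift}]$ (the last one for some power density $\varrho$) exists uniformly on $\Omega$, then its values lie in $[0,1]$, and all these limits, as well as $\lim_{\lambda\to+0}\mathcal V[\mu^\lambda_{\rm scale}]$, exist uniformly on $\Omega$ and coincide, for every power density $\varrho\in\mathfrak D$ and every density $\mu\in\mathfrak D$ that is piecewise continuous on $(0,\infty)$. -/

import Mathlib

open MeasureTheory Filter Topology Set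
open scoped NNReal

namespace StochTauber

noncomputable section

/-- A probability density on the half-line `[0, ∞)`. Such a density is represented by a function on
`ℝ`; its values at negative arguments are irrelevant and are never used. -/
structure IsDensity (ϱ : ℝ → ℝ) : Prop where
  nonneg : ∀ t : ℝ, 0 ≤ t → 0 ≤ ϱ t
  integrable : IntegrableOn ϱ (Ioi 0)
  integral_eq_one : ∫ t in Ioi (0 : ℝ), ϱ t = 1

/-- The density shifted by the time `T` and renormalized. -/
def shift (ϱ : ℝ → ℝ) (T : ℝ) : ℝ → ℝ :=
  fun t => ϱ (t + T) / ∫ s in Ioi T, ϱ s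

/-- The density `t ↦ r ϱ (r t)`. -/
def scale (ϱ : ℝ → ℝ) (r : ℝ) : ℝ → ℝ :=
  fun t => r * ϱ (r * t)

/-- The density of the uniform distribution on `[0, T]`. -/
def uniformDensity (T : ℝ) : ℝ → ℝ :=
  indicator (Icc 0 T) (fun _ => 1 / T)

/-- The density of the exponential distribution with rate `r`. -/
def expDensity (r : ℝ) : ℝ → ℝ :=
  fun t => r * Real.exp (-(r * t))

/-- Power densities: densities of the form `t ↦ (α + β t) ^ (-γ)` with positive `α`, `β`, `γ`. -/
def IsPowerDensity (ϱ : ℝ → ℝ) : Prop :=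
  IsDensity ϱ ∧ ∃ α β γ : ℝ, 0 < α ∧ 0 < β ∧ 0 < γ ∧
    ∀ t : ℝ, 0 ≤ t → ϱ t = 1 / (α + β * t) ^ γ

/-- Piecewise continuity on `(0, ∞)`: every compact subinterval of `(0, ∞)` contains only finitely
many discontinuities, and finite one-sided limits exist at every point. -/
def PiecewiseContinuous (f : ℝ → ℝ) : Prop :=
  (∀ a b : ℝ, 0 < a → {t ∈ Icc a b | ¬ ContinuousAt f t}.Finite) ∧
    ∀ t : ℝ, 0 < t →
      (∃ l : ℝ, Tendsto f (𝓝[<] t) (𝓝 l)) ∧ ∃ l : ℝ, Tendsto f (𝓝[>] t) (𝓝 l)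

variable {Ω : Type*}

/-- The payoff `∫₀^∞ ϱ(t) g(z(t)) dt` of the process `z`. -/
def payoff (g : Ω → ℝ) (ϱ : ℝ → ℝ) (z : ℝ≥0 → Ω) : ℝ :=
  ∫ t in Ioi (0 : ℝ), ϱ t * g (z t.toNNReal)

/-- The processes are constant on each interval `[n, n + 1)`. -/
def PiecewiseConstant (K : Set (ℝ≥0 → Ω)) : Prop :=
  ∀ z ∈ K, ∀ (n : ℕ) (s : ℝ≥0), 0 < s → s < 1 → z (n + s) = z n

section Game

variable {K : Set (ℝ≥0 → Ω)} [MeasurableSpace K] {L M : Ω → Type*}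

/-- The lower value `sup_l inf_m 𝔼^ω_{lm} ∫₀^∞ ϱ(t) g(z(t)) dt` at the initial state `ω`. -/
def value (g : Ω → ℝ) (P : ∀ ω, L ω → M ω → Measure K) (ϱ : ℝ → ℝ) (ω : Ω) : ℝ :=
  ⨆ l : L ω, ⨅ m : M ω, ∫ z : K, payoff g ϱ z ∂(P ω l m)

/-- The dynamic programming identity with intermediate time `T`, for all densities and states. -/
def DPPAt (g : Ω → ℝ) (P : ∀ ω, L ω → M ω → Measure K) (T : ℝ≥0) : Prop :=
  ∀ ϱ : ℝ → ℝ, IsDensity ϱ → ∀ ω : Ω,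
    value g P ϱ ω =
      ⨆ l : L ω, ⨅ m : M ω, ∫ z : K,
        ((∫ t in Ioc (0 : ℝ) T, ϱ t * g (z.1 t.toNNReal)) +
          ⨆ l' : L (z.1 T), ⨅ m' : M (z.1 T), ∫ z₁ : K,
            (∫ t in Ioi (0 : ℝ), ϱ (t + T) * g (z₁.1 t.toNNReal)) ∂(P (z.1 T) l' m'))
        ∂(P ω l m)

/-- For every density `ϱ`, the function `z ↦ 𝒱[ϱ](z(T))` of the process `z` is measurable. -/
def MeasurableValueAt (g : Ω → ℝ) (P : ∀ ω, L ω → M ω → Measure K) (T : ℝ≥0) : Prop :=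
  ∀ ϱ : ℝ → ℝ, IsDensity ϱ → Measurable fun z : K => value g P ϱ (z.1 T)

/-- Condition (c): for every piecewise continuous density `μ` the values of the games with the
scaled densities converge to `U` uniformly as the scaling parameter tends to `+0`. -/
def CondC (g : Ω → ℝ) (P : ∀ ω, L ω → M ω → Measure K) (U : Ω → ℝ) : Prop :=
  ∀ μ : ℝ → ℝ, IsDensity μ → PiecewiseContinuous μ →
    TendstoUniformly (fun r : ℝ => value g P (scale μ r)) U (𝓝[>] 0)

/-- Condition (u): uniform convergence for uniform distributions on growing intervals. -/
def CondU (g : Ω → ℝ) (P : ∀ ω, L ω → M ω → Measure K) (U : Ω → ℝ) : Prop :=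
  TendstoUniformly (fun T : ℝ => value g P (uniformDensity T)) U atTop

/-- Condition (e): uniform convergence for exponential distributions with vanishing rate. -/
def CondE (g : Ω → ℝ) (P : ∀ ω, L ω → M ω → Measure K) (U : Ω → ℝ) : Prop :=
  TendstoUniformly (fun r : ℝ => value g P (expDensity r)) U (𝓝[>] 0)

/-- Condition (p): uniform convergence for the shifts of some power density. -/
def CondP (g : Ω → ℝ) (P : ∀ ω, L ω → M ω → Measure K) (U : Ω → ℝ) : Prop :=
  ∃ ϱ : ℝ → ℝ, IsPowerDensity ϱ ∧
    TendstoUniformly (fun T : ℝ => value g P (shift ϱ T)) U atTop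

/-- Condition (q): uniform convergence for the shifts of every power density. -/
def CondQ (g : Ω → ℝ) (P : ∀ ω, L ω → M ω → Measure K) (U : Ω → ℝ) : Prop :=
  ∀ ϱ : ℝ → ℝ, IsPowerDensity ϱ →
    TendstoUniformly (fun T : ℝ => value g P (shift ϱ T)) U atTop

end Game

end

end StochTauber

/-! The bridge between different families of densities is a property of the limit `U` alone,
`IsAsymptoticallyInvariant`: playing for a long time `h`, collecting the average of `g` with a small
weight `δ` and then `U` at the state reached with weight `1 - δ`, has lower value `U` up to `ε * δ +
η`.

Convergence for one self-similar density `μ` forces this (`IsGame.isAsymptoticallyInvariant`): in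
the dynamic programming identity for a slowly scaled `μ`, the head is nearly constant, and the tail
is a multiple of another slow scaling of `μ`, whose value is again close to `U`.

Conversely, invariance gives convergence for every density (`IsGame.tendstoUniformly_scale`). A
continuous compactly supported density is cut into `k` blocks on which it is nearly constant, and
backward induction (`IsGame.abs_value_sub_mass_mul_le`) applies invariance once per block, with `δ`
the block's share of the remaining mass. The errors `ε * δ`, weighted by the remaining mass, sum to
at most `ε` times the total mass, and the errors `η` to at most `k * η` times a mass bound. Since
`k` is fixed before `η`, both are small. General densities follow by approximation in `L¹`.

Uniform and exponential densities are self-similar, and shifts of a power density are scalings of a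
self-similar one, so every condition is equivalent to convergence for all scaled densities. -/

namespace StochTauber

/-! ### Nonnegative integrable functions on the half-line -/

/-- A nonnegative integrable function on `[0, ∞)`, of arbitrary total mass. -/
structure IsSubdensity (f : ℝ → ℝ) : Prop where
  nonneg : ∀ t : ℝ, 0 ≤ t → 0 ≤ f t
  integrable : IntegrableOn f (Ioi 0)

theorem IsDensity.isSubdensity {f : ℝ → ℝ} (hf : IsDensity f) : IsSubdensity f :=
  ⟨hf.nonneg, hf.integrable⟩

theorem integral_Ioi_comp_add_right (f : ℝ → ℝ) (a b : ℝ) :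
    ∫ t in Ioi a, f (t + b) = ∫ t in Ioi (a + b), f t := by
  have := (measurePreserving_add_right (volume : Measure ℝ) b).setIntegral_preimage_emb
    (measurableEmbedding_addRight b) f (Ioi (a + b))
  simpa using this

theorem integrableOn_Ioi_comp_add_right {f : ℝ → ℝ} {a b : ℝ} :
    IntegrableOn (fun t => f (t + b)) (Ioi a) ↔ IntegrableOn f (Ioi (a + b)) := by
  have := (measurePreserving_add_right (volume : Measure ℝ) b).integrableOn_comp_preimage
    (measurableEmbedding_addRight b) (f := f) (s := Ioi (a + b))
  simpa [Function.comp_def] using this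

theorem integral_Ioi_scale (f : ℝ → ℝ) {r : ℝ} (hr : 0 < r) :
    ∫ t in Ioi (0 : ℝ), scale f r t = ∫ t in Ioi (0 : ℝ), f t := by
  unfold scale
  rw [integral_const_mul, integral_comp_mul_left_Ioi _ _ hr, mul_zero, smul_eq_mul,
    mul_inv_cancel_left₀ hr.ne']

namespace IsSubdensity

variable {f : ℝ → ℝ}

theorem integral_nonneg (hf : IsSubdensity f) : 0 ≤ ∫ t in Ioi (0 : ℝ), f t :=
  setIntegral_nonneg measurableSet_Ioi fun t ht => hf.nonneg t (le_of_lt ht)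

theorem const_mul (hf : IsSubdensity f) {c : ℝ} (hc : 0 ≤ c) : IsSubdensity fun t => c * f t :=
  ⟨fun t ht => mul_nonneg hc (hf.nonneg t ht), hf.integrable.const_mul c⟩

theorem comp_add (hf : IsSubdensity f) {h : ℝ} (hh : 0 ≤ h) : IsSubdensity fun t => f (t + h) :=
  ⟨fun t ht => hf.nonneg _ (add_nonneg ht hh), integrableOn_Ioi_comp_add_right.2
    (hf.integrable.mono_set (Ioi_subset_Ioi (by linarith)))⟩

theorem scale (hf : IsSubdensity f) {r : ℝ} (hr : 0 < r) : IsSubdensity (scale f r) :=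
  ⟨fun t ht => mul_nonneg hr.le (hf.nonneg _ (mul_nonneg hr.le ht)),
    ((integrableOn_Ioi_comp_mul_left_iff f 0 hr).2 (by simpa using hf.integrable)).const_mul r⟩

theorem indicator_Iic (hf : IsSubdensity f) (h : ℝ) : IsSubdensity ((Iic h).indicator f) :=
  ⟨fun t ht => by by_cases h' : t ∈ Iic h <;> simp [h', hf.nonneg t ht], hf.integrable.indicator measurableSet_Iic⟩

theorem integral_Ioc_add_integral_shift (hf : IsSubdensity f) {h : ℝ} (hh : 0 ≤ h) :
    (∫ t in Ioc 0 h, f t) + ∫ t in Ioi (0 : ℝ), f (t + h) = ∫ t in Ioi (0 : ℝ), f t := by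
  rw [integral_Ioi_comp_add_right, zero_add, ← setIntegral_union
    (Ioc_disjoint_Ioi le_rfl) measurableSet_Ioi
    (hf.integrable.mono_set Ioc_subset_Ioi_self)
    (hf.integrable.mono_set (Ioi_subset_Ioi hh)), Ioc_union_Ioi_eq_Ioi hh]

/-- Tails of densities have mass below one; normalizing them makes the hypotheses on densities
applicable, and homogeneity of the value restores the factor. -/
theorem exists_isDensity (hf : IsSubdensity f) (h : (∫ t in Ioi (0 : ℝ), f t) ≠ 0) :
    ∃ ϱ : ℝ → ℝ, IsDensity ϱ ∧ f = fun t => (∫ t in Ioi (0 : ℝ), f t) * ϱ t := by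
  refine ⟨fun t => (∫ t in Ioi (0 : ℝ), f t)⁻¹ * f t, ⟨?_, ?_, ?_⟩, ?_⟩
  · exact (hf.const_mul (inv_nonneg.2 hf.integral_nonneg)).nonneg
  · exact hf.integrable.const_mul _
  · rw [integral_const_mul, inv_mul_cancel₀ h]
  · funext t
    rw [mul_inv_cancel_left₀ h]

end IsSubdensity

theorem isSubdensity_indicator_one (h : ℝ) : IsSubdensity ((Iic h).indicator fun _ => (1 : ℝ)) := by
  refine ⟨fun t _ => indicator_nonneg (fun _ _ => zero_le_one) t, ?_⟩
  rw [IntegrableOn, integrable_indicator_iff measurableSet_Iic, IntegrableOn,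
    Measure.restrict_restrict measurableSet_Iic, inter_comm, Ioi_inter_Iic]
  exact integrableOn_const (by simp)

/-! ### Lower values of bounded functions of the process -/

section Value

variable {Ω : Type*} {K : Set (ℝ≥0 → Ω)} [MeasurableSpace K] {L M : Ω → Type*}

/-- The lower value `sup_l inf_m 𝔼^ω_{lm} F`. -/
noncomputable def lowerVal (P : ∀ ω, L ω → M ω → Measure K) (F : K → ℝ) (ω : Ω) : ℝ :=
  ⨆ l : L ω, ⨅ m : M ω, ∫ z : K, F z ∂(P ω l m)

theorem lowerVal_const_mul (P : ∀ ω, L ω → M ω → Measure K) (F : K → ℝ) {c : ℝ} (hc : 0 ≤ c)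
    (ω : Ω) : lowerVal P (fun z => c * F z) ω = c * lowerVal P F ω := by
  simp only [lowerVal, integral_const_mul, Real.mul_iSup_of_nonneg hc, Real.mul_iInf_of_nonneg hc]

section Bounds

variable [∀ ω, Nonempty (L ω)] [∀ ω, Nonempty (M ω)]
  {P : ∀ ω, L ω → M ω → Measure K} [∀ ω l m, IsProbabilityMeasure (P ω l m)]

theorem lowerVal_const (c : ℝ) (ω : Ω) : lowerVal P (fun _ => c) ω = c := by
  simp [lowerVal]

/-- Measurability and the bound `C` give integrability and bounded ranges. Without them the Bochner
integral and the real `⨆`, `⨅` may take default values and monotonicity may fail. -/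
theorem lowerVal_le_add {F G : K → ℝ} (hF : Measurable F) (hG : Measurable G) {C c : ℝ}
    (hFC : ∀ z, |F z| ≤ C) (hGC : ∀ z, |G z| ≤ C) (h : ∀ z, F z ≤ G z + c) (ω : Ω) :
    lowerVal P F ω ≤ lowerVal P G ω + c := by
  have hiF : ∀ l m, Integrable F (P ω l m) := fun l m =>
    Integrable.of_bound hF.aestronglyMeasurable C (ae_of_all _ hFC)
  have hiG : ∀ l m, Integrable G (P ω l m) := fun l m =>
    Integrable.of_bound hG.aestronglyMeasurable C (ae_of_all _ hGC)
  have hb : ∀ {H : K → ℝ}, (∀ z, |H z| ≤ C) → ∀ l m, |∫ z, H z ∂(P ω l m)| ≤ C := by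
    intro H hH l m
    simpa using norm_integral_le_of_norm_le_const (μ := P ω l m) (f := H) (C := C)
      (ae_of_all _ fun z => by simpa using hH z)
  have hle : ∀ l m, ∫ z, F z ∂(P ω l m) ≤ (∫ z, G z ∂(P ω l m)) + c := by
    intro l m
    have := integral_mono (hiF l m) ((hiG l m).add (integrable_const c)) h
    rwa [integral_add' (hiG l m) (integrable_const c), integral_const, probReal_univ, one_smul]
      at this
  have hbdd : ∀ {H : K → ℝ}, (∀ z, |H z| ≤ C) → ∀ l,
      BddBelow (range fun m : M ω => ∫ z, H z ∂(P ω l m)) := by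
    rintro H hH l
    refine ⟨-C, ?_⟩
    rintro _ ⟨m, rfl⟩
    exact (abs_le.1 (hb hH l m)).1
  refine ciSup_le fun l => ?_
  have h1 : (⨅ m : M ω, ∫ z, F z ∂(P ω l m)) - c ≤ ⨅ m : M ω, ∫ z, G z ∂(P ω l m) :=
    le_ciInf fun m => by linarith [ciInf_le (hbdd hFC l) m, hle l m]
  have h2 : (⨅ m : M ω, ∫ z, G z ∂(P ω l m)) ≤ lowerVal P G ω := by
    refine le_ciSup (f := fun l => ⨅ m : M ω, ∫ z, G z ∂(P ω l m)) ⟨C, ?_⟩ l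
    rintro _ ⟨l', rfl⟩
    obtain ⟨m⟩ := (inferInstance : Nonempty (M ω))
    exact (ciInf_le (hbdd hGC l') m).trans (abs_le.1 (hb hGC l' m)).2
  linarith

theorem abs_lowerVal_sub_le {F G : K → ℝ} (hF : Measurable F) (hG : Measurable G) {C c : ℝ}
    (hGC : ∀ z, |G z| ≤ C) (h : ∀ z, |F z - G z| ≤ c) (ω : Ω) :
    |lowerVal P F ω - lowerVal P G ω| ≤ c := by
  have hF' : ∀ z, |F z| ≤ C + c := fun z => by
    have := abs_add_le (F z - G z) (G z)
    rw [sub_add_cancel] at this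
    linarith [h z, hGC z]
  have hG' : ∀ z, |G z| ≤ C + c := fun z => by linarith [hGC z, h z, abs_nonneg (F z - G z)]
  have h1 := lowerVal_le_add (P := P) (c := c) hF hG hF' hG'
    (fun z => by linarith [(abs_le.1 (h z)).2]) ω
  have h2 := lowerVal_le_add (P := P) (c := c) hG hF hG' hF'
    (fun z => by linarith [(abs_le.1 (h z)).1]) ω
  exact abs_le.2 ⟨by linarith, by linarith⟩

end Bounds

/-! ### Payoffs and values of subdensities -/

/-- The standing assumptions, with the dynamic programming identity at integer times only. -/
structure IsGame (g : Ω → ℝ) (P : ∀ ω, L ω → M ω → Measure K) : Prop where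
  mem_Icc : ∀ ω, g ω ∈ Icc (0 : ℝ) 1
  aemeasurable : ∀ z ∈ K, AEMeasurable (fun t : ℝ => g (z t.toNNReal)) (volume.restrict (Ioi 0))
  measurable_payoff_density : ∀ ϱ : ℝ → ℝ, IsDensity ϱ → Measurable fun z : K => payoff g ϱ z
  measurable_value_density : ∀ n : ℕ, 0 < n → MeasurableValueAt g P (n : ℝ≥0)
  dpp_density : ∀ n : ℕ, 0 < n → DPPAt g P (n : ℝ≥0)

theorem payoff_congr (g : Ω → ℝ) {f f' : ℝ → ℝ} (h : ∀ t, 0 < t → f t = f' t) (z : ℝ≥0 → Ω) :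
    payoff g f z = payoff g f' z :=
  setIntegral_congr_fun measurableSet_Ioi fun t ht => by simp only [h t ht]

theorem value_congr (g : Ω → ℝ) (P : ∀ ω, L ω → M ω → Measure K) {f f' : ℝ → ℝ}
    (h : ∀ t, 0 < t → f t = f' t) : value g P f = value g P f' := by
  funext ω
  simp only [value, payoff_congr g h]

theorem payoff_const_mul (g : Ω → ℝ) (f : ℝ → ℝ) (c : ℝ) (z : ℝ≥0 → Ω) :
    payoff g (fun t => c * f t) z = c * payoff g f z := by
  simp only [payoff, mul_assoc, integral_const_mul]

theorem value_eq_lowerVal (g : Ω → ℝ) (P : ∀ ω, L ω → M ω → Measure K) (f : ℝ → ℝ) (ω : Ω) :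
    value g P f ω = lowerVal P (fun z => payoff g f z) ω := rfl

theorem value_const_mul (g : Ω → ℝ) (P : ∀ ω, L ω → M ω → Measure K) (f : ℝ → ℝ) {c : ℝ}
    (hc : 0 ≤ c) (ω : Ω) : value g P (fun t => c * f t) ω = c * value g P f ω := by
  simp only [value_eq_lowerVal, payoff_const_mul, lowerVal_const_mul P _ hc]

theorem payoff_indicator_Iic (g : Ω → ℝ) (f : ℝ → ℝ) (h : ℝ) (z : ℝ≥0 → Ω) :
    payoff g ((Iic h).indicator f) z = ∫ t in Ioc 0 h, f t * g (z t.toNNReal) := by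
  rw [payoff, ← Ioi_inter_Iic, ← setIntegral_indicator measurableSet_Iic]
  congr 1
  funext t
  by_cases ht : t ∈ Iic h <;> simp [ht]

namespace IsGame

variable {g : Ω → ℝ} {P : ∀ ω, L ω → M ω → Measure K}

theorem integrableOn_mul (G : IsGame g P) {f : ℝ → ℝ} (hf : IntegrableOn f (Ioi 0)) (z : K) :
    IntegrableOn (fun t => f t * g (z.1 t.toNNReal)) (Ioi 0) :=
  Integrable.mul_bdd (c := 1) hf (G.aemeasurable z z.2).aestronglyMeasurable
    (ae_of_all _ fun t => by
      rw [Real.norm_of_nonneg (G.mem_Icc _).1]; exact (G.mem_Icc _).2)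

theorem payoff_mem_Icc (G : IsGame g P) {f : ℝ → ℝ} (hf : IsSubdensity f) (z : K) :
    payoff g f z ∈ Icc 0 (∫ t in Ioi (0 : ℝ), f t) := by
  constructor
  · exact setIntegral_nonneg measurableSet_Ioi fun t ht =>
      mul_nonneg (hf.nonneg t (le_of_lt ht)) (G.mem_Icc _).1
  · exact setIntegral_mono_on (G.integrableOn_mul hf.integrable z) hf.integrable measurableSet_Ioi
      fun t ht => mul_le_of_le_one_right (hf.nonneg t (le_of_lt ht)) (G.mem_Icc _).2

theorem abs_payoff_le (G : IsGame g P) {f : ℝ → ℝ} (hf : IsSubdensity f) (z : K) :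
    |payoff g f z| ≤ ∫ t in Ioi (0 : ℝ), f t := by
  rw [abs_of_nonneg (G.payoff_mem_Icc hf z).1]
  exact (G.payoff_mem_Icc hf z).2

theorem abs_payoff_sub_le (G : IsGame g P) {f f' : ℝ → ℝ} (hf : IntegrableOn f (Ioi 0))
    (hf' : IntegrableOn f' (Ioi 0)) (z : K) :
    |payoff g f z - payoff g f' z| ≤ ∫ t in Ioi (0 : ℝ), |f t - f' t| := by
  rw [payoff, payoff, ← integral_sub (G.integrableOn_mul hf z) (G.integrableOn_mul hf' z)]
  rw [← Real.norm_eq_abs]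
  refine norm_integral_le_of_norm_le (g := fun t => |f t - f' t|) (hf.sub hf').abs
    (ae_of_all _ fun t => ?_)
  rw [← sub_mul, norm_mul, Real.norm_eq_abs, Real.norm_of_nonneg (G.mem_Icc _).1]
  exact mul_le_of_le_one_right (abs_nonneg _) (G.mem_Icc _).2

theorem measurable_payoff (G : IsGame g P) {f : ℝ → ℝ} (hf : IsSubdensity f) :
    Measurable fun z : K => payoff g f z := by
  by_cases h : (∫ t in Ioi (0 : ℝ), f t) = 0
  · have : (fun z : K => payoff g f z) = fun _ => 0 := by
      funext z
      have := G.payoff_mem_Icc hf z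
      rw [h] at this
      exact le_antisymm this.2 this.1
    rw [this]
    exact measurable_const
  · obtain ⟨ϱ, hϱ, hf'⟩ := hf.exists_isDensity h
    rw [hf']
    simp only [payoff_const_mul]
    exact (G.measurable_payoff_density ϱ hϱ).const_mul _

theorem measurable_integral_Ioc (G : IsGame g P) {f : ℝ → ℝ} (hf : IsSubdensity f) (h : ℝ) :
    Measurable fun z : K => ∫ t in Ioc 0 h, f t * g (z.1 t.toNNReal) := by
  simp only [← payoff_indicator_Iic]
  exact G.measurable_payoff (hf.indicator_Iic h)

theorem measurable_average (G : IsGame g P) (h : ℝ) :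
    Measurable fun z : K => ∫ t in Ioc 0 h, g (z.1 t.toNNReal) := by
  have := G.measurable_payoff (isSubdensity_indicator_one h)
  simpa only [payoff_indicator_Iic, one_mul] using this

theorem integral_g_mem_Icc (G : IsGame g P) {h : ℝ} (hh : 0 ≤ h) (z : K) :
    (∫ t in Ioc 0 h, g (z.1 t.toNNReal)) ∈ Icc 0 h := by
  constructor
  · exact setIntegral_nonneg measurableSet_Ioc fun t _ => (G.mem_Icc _).1
  · have : ‖∫ t in Ioc 0 h, g (z.1 t.toNNReal)‖ ≤ 1 * volume.real (Ioc 0 h) :=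
      norm_setIntegral_le_of_norm_le_const (by simp) fun t _ => by
        rw [Real.norm_of_nonneg (G.mem_Icc _).1]; exact (G.mem_Icc _).2
    rw [Real.volume_real_Ioc_of_le hh, one_mul, sub_zero] at this
    exact (le_abs_self _).trans this

theorem abs_integral_Ioc_sub_le (G : IsGame g P) {f : ℝ → ℝ} (hf : IntegrableOn f (Ioi 0))
    {a h o : ℝ} (hh : 0 ≤ h) (hfa : ∀ t ∈ Ioc 0 h, |f t - a| ≤ o) (z : K) :
    |(∫ t in Ioc 0 h, f t * g (z.1 t.toNNReal)) - a * ∫ t in Ioc 0 h, g (z.1 t.toNNReal)|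
      ≤ o * h := by
  have hi : IntegrableOn (fun t => g (z.1 t.toNNReal)) (Ioc 0 h) :=
    Integrable.of_bound
      ((G.aemeasurable z z.2).mono_set Ioc_subset_Ioi_self).aestronglyMeasurable 1
      (ae_of_all _ fun t => by
        rw [Real.norm_of_nonneg (G.mem_Icc _).1]; exact (G.mem_Icc _).2)
  rw [← integral_const_mul, ← integral_sub
    ((G.integrableOn_mul hf z).mono_set Ioc_subset_Ioi_self) (hi.const_mul a)]
  have : ‖∫ t in Ioc 0 h, (f t * g (z.1 t.toNNReal) - a * g (z.1 t.toNNReal))‖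
      ≤ o * volume.real (Ioc 0 h) :=
    norm_setIntegral_le_of_norm_le_const (by simp) fun t ht => by
      rw [← sub_mul, norm_mul, Real.norm_eq_abs, Real.norm_of_nonneg (G.mem_Icc _).1]
      exact (mul_le_of_le_one_right (abs_nonneg _) (G.mem_Icc _).2).trans (hfa t ht)
  rwa [Real.volume_real_Ioc_of_le hh, sub_zero] at this

variable [∀ ω, Nonempty (L ω)] [∀ ω, Nonempty (M ω)]
  [∀ ω l m, IsProbabilityMeasure (P ω l m)]

theorem value_mem_Icc (G : IsGame g P) {f : ℝ → ℝ} (hf : IsSubdensity f) (ω : Ω) :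
    value g P f ω ∈ Icc 0 (∫ t in Ioi (0 : ℝ), f t) := by
  have h0 : ∀ z : K, |(fun _ : K => (0 : ℝ)) z| ≤ ∫ t in Ioi (0 : ℝ), f t := fun z => by
    simpa using hf.integral_nonneg
  rw [value_eq_lowerVal]
  constructor
  · have := lowerVal_le_add (P := P) (c := 0) measurable_const (G.measurable_payoff hf) h0
      (G.abs_payoff_le hf) (fun z => by simpa using (G.payoff_mem_Icc hf z).1) ω
    rwa [lowerVal_const, add_zero] at this
  · have := lowerVal_le_add (P := P) (G.measurable_payoff hf) measurable_const
      (G.abs_payoff_le hf) h0 (fun z => by simpa using (G.payoff_mem_Icc hf z).2) ω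
    rwa [lowerVal_const, zero_add] at this

/-- As `g` takes values in `[0, 1]`, payoffs are 1-Lipschitz in the `L¹` norm of the density
uniformly over processes, and `sup inf` of expectations preserves uniform bounds. -/
theorem abs_value_sub_le (G : IsGame g P) {f f' : ℝ → ℝ} (hf : IsSubdensity f)
    (hf' : IsSubdensity f') (ω : Ω) :
    |value g P f ω - value g P f' ω| ≤ ∫ t in Ioi (0 : ℝ), |f t - f' t| :=
  abs_lowerVal_sub_le (G.measurable_payoff hf) (G.measurable_payoff hf') (G.abs_payoff_le hf')
    (G.abs_payoff_sub_le hf.integrable hf'.integrable) ω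

theorem measurable_value (G : IsGame g P) {f : ℝ → ℝ} (hf : IsSubdensity f) {n : ℕ} (hn : 0 < n) :
    Measurable fun z : K => value g P f (z.1 n) := by
  by_cases h : (∫ t in Ioi (0 : ℝ), f t) = 0
  · have : (fun z : K => value g P f (z.1 n)) = fun _ => 0 := by
      funext z
      have := G.value_mem_Icc hf (z.1 n)
      rw [h] at this
      exact le_antisymm this.2 this.1
    rw [this]
    exact measurable_const
  · obtain ⟨ϱ, hϱ, hf'⟩ := hf.exists_isDensity h
    rw [hf']
    simp only [value_const_mul g P ϱ hf.integral_nonneg]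
    exact (G.measurable_value_density n hn ϱ hϱ).const_mul _

theorem value_eq_lowerVal_shift (G : IsGame g P) {f : ℝ → ℝ} (hf : IsSubdensity f) {n : ℕ}
    (hn : 0 < n) (ω : Ω) :
    value g P f ω = lowerVal P (fun z => (∫ t in Ioc (0 : ℝ) n, f t * g (z.1 t.toNNReal)) +
      value g P (fun t => f (t + n)) (z.1 n)) ω := by
  -- Zero mass cannot be normalized, but then both sides vanish.
  by_cases h : (∫ t in Ioi (0 : ℝ), f t) = 0
  · have hs := hf.comp_add (Nat.cast_nonneg (α := ℝ) n)
    have hw : 0 ≤ ∫ t in Ioc (0 : ℝ) n, f t :=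
      setIntegral_nonneg measurableSet_Ioc fun t ht => hf.nonneg t ht.1.le
    have hsplit := hf.integral_Ioc_add_integral_shift (Nat.cast_nonneg (α := ℝ) n)
    have hz : (fun z : K => (∫ t in Ioc (0 : ℝ) n, f t * g (z.1 t.toNNReal)) +
        value g P (fun t => f (t + n)) (z.1 n)) = fun _ => 0 := by
      funext z
      have h1 := G.payoff_mem_Icc (hf.indicator_Iic n) z
      rw [payoff_indicator_Iic, setIntegral_indicator measurableSet_Iic, Ioi_inter_Iic] at h1
      have h2 := G.value_mem_Icc hs (z.1 n)
      have h3 := hs.integral_nonneg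
      linarith [h1.1, h1.2, h2.1, h2.2]
    have := G.value_mem_Icc hf ω
    rw [h] at this
    rw [hz, lowerVal_const]
    exact le_antisymm this.2 this.1
  · obtain ⟨ϱ, hϱ, hf'⟩ := hf.exists_isDensity h
    set c := ∫ t in Ioi (0 : ℝ), f t
    have hc : 0 ≤ c := hf.integral_nonneg
    rw [hf', value_const_mul g P ϱ hc, G.dpp_density n hn ϱ hϱ ω]
    simp only [value_const_mul g P (fun t => ϱ (t + n)) hc, mul_assoc, integral_const_mul,
      ← mul_add, lowerVal_const_mul P _ hc]
    rfl

end IsGame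

end Value

theorem integral_Ioc_sub_const_le {f : ℝ → ℝ} {h a o : ℝ} (hh : 0 ≤ h)
    (hf : IntegrableOn f (Ioc 0 h)) (hfa : ∀ t ∈ Ioc 0 h, |f t - a| ≤ o) :
    |(∫ t in Ioc 0 h, f t) - a * h| ≤ o * h := by
  have hc : (∫ _ in Ioc 0 h, a) = a * h := by
    rw [setIntegral_const, Real.volume_real_Ioc_of_le hh, sub_zero, smul_eq_mul, mul_comm]
  rw [← hc, ← integral_sub hf (integrableOn_const (by simp))]
  have : ‖∫ t in Ioc 0 h, (f t - a)‖ ≤ o * volume.real (Ioc 0 h) :=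
    norm_setIntegral_le_of_norm_le_const (by simp) hfa
  rwa [Real.volume_real_Ioc_of_le hh, sub_zero] at this

/-! ### From asymptotic invariance to convergence for all scaled densities -/

section Invariance

variable {Ω : Type*} {K : Set (ℝ≥0 → Ω)} [MeasurableSpace K] {L M : Ω → Type*}

/-- The convex combination, with weights `δ` and `1 - δ`, of the average of `g` along the process
over `[0, h]` and of the value of `U` at time `h`. -/
noncomputable def blend (g U : Ω → ℝ) (h : ℕ) (δ : ℝ) (z : K) : ℝ :=
  δ / h * (∫ t in Ioc (0 : ℝ) h, g (z.1 t.toNNReal)) + (1 - δ) * U (z.1 h)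

/-- Up to an error negligible with respect to `δ`, the function `U` is a fixed point of the
dynamic programming operator associated with a long first period of weight `δ`. -/
def IsAsymptoticallyInvariant (g : Ω → ℝ) (P : ∀ ω, L ω → M ω → Measure K) (U : Ω → ℝ) : Prop :=
  ∀ ε : ℝ, 0 < ε → ∃ δ₀ : ℝ, 0 < δ₀ ∧ ∀ η : ℝ, 0 < η → ∃ H : ℕ, ∀ h : ℕ, 0 < h → H ≤ h →
    ∀ δ : ℝ, 0 ≤ δ → δ ≤ δ₀ → ∀ ω, |U ω - lowerVal P (blend g U h δ) ω| ≤ ε * δ + η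

namespace IsGame

variable {g : Ω → ℝ} {P : ∀ ω, L ω → M ω → Measure K} {U : Ω → ℝ}

theorem measurable_blend (G : IsGame g P) {h : ℕ} (hU : Measurable fun z : K => U (z.1 h))
    (δ : ℝ) : Measurable (blend (K := K) g U h δ) :=
  ((G.measurable_average h).const_mul _).add (hU.const_mul _)

theorem average_mem_Icc (G : IsGame g P) {h : ℕ} (hh : 0 < h) (z : K) :
    (∫ t in Ioc (0 : ℝ) h, g (z.1 t.toNNReal)) / h ∈ Icc (0 : ℝ) 1 := by
  have h0 : (0 : ℝ) < h := Nat.cast_pos.2 hh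
  have := G.integral_g_mem_Icc h0.le z
  exact ⟨div_nonneg this.1 h0.le, (div_le_one h0).2 this.2⟩

theorem abs_blend_sub_le (G : IsGame g P) (hU : ∀ ω, U ω ∈ Icc (0 : ℝ) 1) {h : ℕ} (hh : 0 < h)
    {δ : ℝ} (hδ : 0 ≤ δ) (z : K) : |blend g U h δ z - U (z.1 h)| ≤ δ := by
  have h1 := G.average_mem_Icc hh z
  have h2 := hU (z.1 h)
  have : blend g U h δ z - U (z.1 h) =
      δ * ((∫ t in Ioc (0 : ℝ) h, g (z.1 t.toNNReal)) / h - U (z.1 h)) := by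
    unfold blend; ring
  rw [this, abs_mul, abs_of_nonneg hδ]
  exact mul_le_of_le_one_right hδ (abs_le.2 ⟨by linarith [h1.1, h2.2], by linarith [h1.2, h2.1]⟩)

theorem abs_blend_le (G : IsGame g P) (hU : ∀ ω, U ω ∈ Icc (0 : ℝ) 1) {h : ℕ} (hh : 0 < h)
    {δ : ℝ} (hδ : 0 ≤ δ) (z : K) : |blend g U h δ z| ≤ δ + 1 := by
  have h1 := G.abs_blend_sub_le hU hh hδ z
  have h2 := abs_sub_abs_le_abs_sub (blend g U h δ z) (U (z.1 h))
  have h3 := hU (z.1 h)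
  rw [abs_of_nonneg h3.1] at h2
  linarith [h3.2]

variable [∀ ω, Nonempty (L ω)] [∀ ω, Nonempty (M ω)]
  [∀ ω l m, IsProbabilityMeasure (P ω l m)]

/-- Backward induction along steps of length `h`. -/
theorem abs_value_sub_mass_mul_le (G : IsGame g P) (hU : ∀ ω, U ω ∈ Icc (0 : ℝ) 1)
    {h : ℕ} (hh : 0 < h) (hUm : Measurable fun z : K => U (z.1 h)) {ε δ₀ η κ B o A : ℝ}
    (hε : 0 ≤ ε) (hη : 0 ≤ η) (hκ : 0 < κ) (ho : 0 ≤ o) (hA : 0 ≤ A) (hδ₀ : 0 ≤ δ₀)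
    (hBh : B * h ≤ δ₀ * κ)
    (hloc : ∀ δ : ℝ, 0 ≤ δ → δ ≤ δ₀ → ∀ ω, |U ω - lowerVal P (blend g U h δ) ω| ≤ ε * δ + η) :
    ∀ (k : ℕ) (f : ℝ → ℝ), IsSubdensity f → (∀ t, 0 < t → f t ≤ B) →
      (∀ s t, 0 < s → 0 < t → |s - t| ≤ (h : ℝ) → |f s - f t| ≤ o) →
      (∀ t : ℝ, k * h < t → f t = 0) → (∫ t in Ioi (0 : ℝ), f t) ≤ A → ∀ ω,
      |value g P f ω - (∫ t in Ioi (0 : ℝ), f t) * U ω|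
        ≤ κ + ε * (∫ t in Ioi (0 : ℝ), f t) + k * (η * A + o * h) := by
  have hh0 : (0 : ℝ) < h := Nat.cast_pos.2 hh
  intro k
  induction k with
  | zero =>
    intro f hf _ _ hf0 _ ω
    have hm : (∫ t in Ioi (0 : ℝ), f t) = 0 :=
      setIntegral_eq_zero_of_forall_eq_zero fun t ht => hf0 t (by simpa using ht)
    have hv := G.value_mem_Icc hf ω
    rw [hm] at hv ⊢
    rw [le_antisymm hv.2 hv.1]
    simpa using hκ.le
  | succ k ih =>
    intro f hf hfB hfo hf0 hfA ω
    have hW := hf.integral_nonneg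
    have hs := hf.comp_add hh0.le
    have hW' := hs.integral_nonneg
    have hsplit := hf.integral_Ioc_add_integral_shift hh0.le
    have hw : 0 ≤ ∫ t in Ioc (0 : ℝ) h, f t :=
      setIntegral_nonneg measurableSet_Ioc fun t ht => hf.nonneg t ht.1.le
    have hiI : IntegrableOn f (Ioc (0 : ℝ) h) := hf.integrable.mono_set Ioc_subset_Ioi_self
    have hwB : (∫ t in Ioc (0 : ℝ) h, f t) ≤ B * h := by
      have := setIntegral_mono_on hiI (continuous_const.integrableOn_Ioc (f := fun _ : ℝ => B)) measurableSet_Ioc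
        fun t ht => hfB t ht.1
      rwa [setIntegral_const, Real.volume_real_Ioc_of_le hh0.le, sub_zero, smul_eq_mul,
        mul_comm] at this
    have hosc : ∀ t ∈ Ioc (0 : ℝ) h, |f t - (∫ t in Ioc (0 : ℝ) h, f t) / h| ≤ o := by
      intro t ht
      have := integral_Ioc_sub_const_le (a := f t) (o := o) hh0.le hiI fun s hs =>
        hfo s t hs.1 ht.1 (abs_le.2 ⟨by linarith [hs.1, ht.2], by linarith [hs.2, ht.1]⟩)
      have he : f t - (∫ t in Ioc (0 : ℝ) h, f t) / h =
          -((∫ t in Ioc (0 : ℝ) h, f t) - f t * h) / h := by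
        field_simp
        ring
      rw [he, abs_div, abs_neg, abs_of_pos hh0, div_le_iff₀ hh0]
      exact this
    have ih' := ih (fun t => f (t + h)) hs
      (fun t ht => hfB _ (by linarith))
      (fun s t hs ht hst => hfo _ _ (by linarith) (by linarith) (by simpa using hst))
      (fun t ht => hf0 _ (by push_cast; linarith)) (by linarith)
    set W := ∫ t in Ioi (0 : ℝ), f t
    set W' := ∫ t in Ioi (0 : ℝ), f (t + h)
    set w := ∫ t in Ioc (0 : ℝ) h, f t
    have hstep : 0 ≤ η * A + o * h := by positivity
    -- Once the remaining mass is at most `κ`, both quantities lie in `[0, W]` and the recursion is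
    -- dropped. Otherwise `w ≤ B * h ≤ δ₀ * κ ≤ δ₀ * W`, so invariance is available with `δ = w /
    -- W`.
    rcases le_or_gt W κ with hWκ | hWκ
    · have hv := G.value_mem_Icc hf ω
      have hWU : W * U ω ∈ Icc 0 W :=
        ⟨mul_nonneg hW (hU ω).1, mul_le_of_le_one_right hW (hU ω).2⟩
      have h1 : |value g P f ω - W * U ω| ≤ W :=
        abs_le.2 ⟨by linarith [hv.1, hWU.2], by linarith [hv.2, hWU.1]⟩
      have h2 : 0 ≤ ε * W + ((k + 1 : ℕ) : ℝ) * (η * A + o * h) := by positivity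
      linarith
    · have hW0 : 0 < W := hκ.trans hWκ
      have hδ : w / W ≤ δ₀ := (div_le_iff₀ hW0).2
        (hwB.trans (hBh.trans (mul_le_mul_of_nonneg_left hWκ.le hδ₀)))
      have hδ' : 0 ≤ w / W := div_nonneg hw hW0.le
      have hloc' := hloc _ hδ' hδ ω
      have hF : ∀ z : K, |((∫ t in Ioc (0 : ℝ) h, f t * g (z.1 t.toNNReal)) +
          value g P (fun t => f (t + h)) (z.1 h)) - W * blend g U h (w / W) z| ≤
          o * h + (κ + ε * W' + k * (η * A + o * h)) := by
        intro z
        have h1 := G.abs_integral_Ioc_sub_le hf.integrable hh0.le hosc z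
        have h2 := ih' (z.1 h)
        have h3 : W * blend g U h (w / W) z =
            w / h * (∫ t in Ioc (0 : ℝ) h, g (z.1 t.toNNReal)) + W' * U (z.1 h) := by
          unfold blend
          rw [show W' = W - w by linarith]
          field_simp
        rw [h3, add_sub_add_comm]
        exact (abs_add_le _ _).trans (add_le_add h1 h2)
      have hb : ∀ z : K, |W * blend g U h (w / W) z| ≤ W * (w / W + 1) := fun z => by
        rw [abs_mul, abs_of_pos hW0]
        exact mul_le_mul_of_nonneg_left (G.abs_blend_le hU hh hδ' z) hW0.le
      have h4 := abs_lowerVal_sub_le (P := P)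
        ((G.measurable_integral_Ioc hf h).add (G.measurable_value hs hh))
        ((G.measurable_blend hUm (w / W)).const_mul W) hb hF ω
      rw [lowerVal_const_mul P _ hW0.le] at h4
      have h5 : |W * lowerVal P (blend g U h (w / W)) ω - W * U ω| ≤ ε * w + η * A := by
        rw [← mul_sub, abs_mul, abs_of_pos hW0, abs_sub_comm]
        calc W * |U ω - lowerVal P (blend g U h (w / W)) ω| ≤ W * (ε * (w / W) + η) :=
              mul_le_mul_of_nonneg_left hloc' hW0.le
          _ = ε * w + η * W := by field_simp
          _ ≤ ε * w + η * A := by gcongr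
      rw [G.value_eq_lowerVal_shift hf hh]
      -- The error `κ` is inherited unchanged, and `ε * w` joins `ε * W'` to give `ε * W`; only `η *
      -- A + o * h` is paid at each step.
      have h6 := (abs_sub_le _ _ _).trans (add_le_add h4 h5)
      refine h6.trans (le_of_eq ?_)
      rw [← hsplit]
      push_cast
      ring

/-- Asymptotic invariance gives uniform convergence of the values for compactly supported
continuous densities under scaling. -/
theorem eventually_abs_value_scale_sub_le (G : IsGame g P) (hU : ∀ ω, U ω ∈ Icc (0 : ℝ) 1)
    (hUm : ∀ n : ℕ, 0 < n → Measurable fun z : K => U (z.1 n))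
    (hinv : IsAsymptoticallyInvariant g P U) {f : ℝ → ℝ} (hf : IsSubdensity f)
    (hfc : Continuous f) (hfs : HasCompactSupport f) (hf2 : (∫ t in Ioi (0 : ℝ), f t) ≤ 2)
    {e : ℝ} (he : 0 < e) :
    ∀ᶠ r in 𝓝[>] (0 : ℝ), ∀ ω,
      |value g P (scale f r) ω - (∫ t in Ioi (0 : ℝ), f t) * U ω| ≤ e := by
  obtain ⟨B₀, hB₀⟩ := hfs.exists_bound_of_continuous hfc
  obtain ⟨B, hB0, hB⟩ : ∃ B, 0 < B ∧ ∀ t, f t ≤ B :=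
    ⟨max B₀ 1, by positivity, fun t => (le_abs_self _).trans ((hB₀ t).trans (le_max_left _ _))⟩
  obtain ⟨R₀, hR₀⟩ := hfs.isBounded.subset_closedBall (0 : ℝ)
  obtain ⟨R, hR0, hR⟩ : ∃ R : ℝ, 0 < R ∧ ∀ t, R < t → f t = 0 := by
    refine ⟨max R₀ 1, by positivity, fun t ht => ?_⟩
    by_contra h
    have := hR₀ (subset_tsupport f h)
    rw [Metric.mem_closedBall, dist_zero_right, Real.norm_eq_abs] at this
    linarith [le_max_left R₀ 1, le_abs_self t]
  -- The error `e` is split into four quarters: the cutoff `κ`, the term `ε * mass` with mass at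
  -- most 2, and the `k`-fold sums of `η * A` and of the oscillation.
  obtain ⟨δ₀, hδ₀, hinv'⟩ := hinv (e / 8) (by positivity)
  set o := e / (4 * (2 * R + 1)) with ho_def
  have ho : 0 < o := by positivity
  obtain ⟨d₁, hd₁, hd₁o⟩ :=
    Metric.uniformContinuous_iff.1 (hfs.uniformContinuous_of_continuous hfc) o ho
  -- In the unscaled time of `f` a block will have length `r * h` in `[d / 2, d]`. The lower bound
  -- explains `2 * R ≤ k * d` below: `k` blocks must cover the support.
  obtain ⟨d, hd0, hdd₁, hd1, hdB⟩ : ∃ d : ℝ, 0 < d ∧ d < d₁ ∧ d ≤ 1 ∧ B * d ≤ δ₀ * (e / 4) := by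
    refine ⟨min (d₁ / 2) (min 1 (δ₀ * (e / 4) / B)), by positivity, ?_, ?_, ?_⟩
    · exact (min_le_left _ _).trans_lt (by linarith)
    · exact (min_le_right _ _).trans (min_le_left _ _)
    · rw [mul_comm, ← le_div_iff₀ hB0]
      exact (min_le_right _ _).trans (min_le_right _ _)
  obtain ⟨k, hk1, hk2⟩ : ∃ k : ℕ, 2 * R ≤ k * d ∧ k * d ≤ 2 * R + 1 := by
    refine ⟨⌈2 * R / d⌉₊, ?_, ?_⟩
    · rw [← div_le_iff₀ hd0]
      exact Nat.le_ceil _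
    · have := (Nat.ceil_lt_add_one (a := 2 * R / d) (by positivity)).le
      have := mul_le_mul_of_nonneg_right this hd0.le
      rw [add_mul, div_mul_cancel₀ _ hd0.ne', one_mul] at this
      linarith
  -- Here the quantifier order in `IsAsymptoticallyInvariant` matters: `k` depends on `δ₀`, and `η`
  -- must be small relative to `1 / k`.
  obtain ⟨H, hH⟩ := hinv' (e / (8 * (k + 1))) (by positivity)
  -- The summand 2 makes `h ≥ 2`, so that rounding `d / r` down loses at most half of the block.
  have hr₀ : 0 < d / (H + 2) := by positivity
  filter_upwards [Ioo_mem_nhdsGT hr₀] with r hr ω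
  obtain ⟨hr0, hr1⟩ := hr
  have hdr : (H + 2 : ℝ) < d / r := by
    rw [lt_div_iff₀ hr0]
    rw [lt_div_iff₀ (by positivity)] at hr1
    linarith
  set h := ⌊d / r⌋₊
  have hHh : H + 2 ≤ h := Nat.le_floor (by push_cast; exact hdr.le)
  have hh : 0 < h := by omega
  have hh0 : (0 : ℝ) < h := Nat.cast_pos.2 hh
  have hrh : r * h ≤ d := by
    have := Nat.floor_le (a := d / r) (by positivity)
    rw [le_div_iff₀ hr0] at this
    linarith
  have hrh' : d / 2 ≤ r * h := by
    have h1 := (Nat.lt_floor_add_one (d / r)).le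
    have h2 : (2 : ℝ) ≤ h := by exact_mod_cast (by omega : 2 ≤ h)
    rw [div_le_iff₀ hr0] at h1
    have : (h + 1 : ℝ) * r ≤ (2 * h) * r := mul_le_mul_of_nonneg_right (by linarith) hr0.le
    linarith
  have key := G.abs_value_sub_mass_mul_le hU hh (hUm h hh) (ε := e / 8)
    (η := e / (8 * (k + 1))) (κ := e / 4) (B := r * B) (o := r * o) (A := 2)
    (by positivity) (by positivity) (by positivity) (by positivity) (by positivity) hδ₀.le
    (by
      calc r * B * h = B * (r * h) := by ring
        _ ≤ B * d := by gcongr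
        _ ≤ _ := hdB)
    (hH h hh (by omega)) k (scale f r) (hf.scale hr0)
    (fun t _ => mul_le_mul_of_nonneg_left (hB _) hr0.le)
    (fun s t _ _ hst => by
      rw [scale, scale, ← mul_sub, abs_mul, abs_of_pos hr0]
      refine mul_le_mul_of_nonneg_left (le_of_lt ?_) hr0.le
      rw [← Real.dist_eq]
      refine hd₁o ?_
      rw [Real.dist_eq, ← mul_sub, abs_mul, abs_of_pos hr0]
      exact ((mul_le_mul_of_nonneg_left hst hr0.le).trans hrh).trans_lt hdd₁)
    (fun t ht => by
      rw [scale, hR, mul_zero]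
      calc R ≤ k * (d / 2) := by linarith
        _ ≤ k * (r * h) := by gcongr
        _ = r * (k * h) := by ring
        _ < r * t := by gcongr)
    (by rwa [integral_Ioi_scale f hr0]) ω
  rw [integral_Ioi_scale f hr0] at key
  refine key.trans ?_
  have h1 : (k : ℝ) * (e / (8 * (k + 1)) * 2) ≤ e / 4 := by
    rw [show (k : ℝ) * (e / (8 * (k + 1)) * 2) = e / 4 * (k / (k + 1)) by field_simp; ring]
    exact mul_le_of_le_one_right (by positivity) ((div_le_one (by positivity)).2 (by linarith))
  have h2 : (k : ℝ) * (r * o * h) ≤ e / 4 := by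
    calc (k : ℝ) * (r * o * h) = k * (r * h) * o := by ring
      _ ≤ k * d * o := by gcongr
      _ ≤ (2 * R + 1) * o := by gcongr
      _ = e / 4 := by rw [ho_def]; field_simp
  have h3 : e / 8 * (∫ t in Ioi (0 : ℝ), f t) ≤ e / 8 * 2 := by gcongr
  linarith

end IsGame

/-- Compactly supported continuous functions are dense in `L¹`; since `ν ≥ 0` on the half-line,
taking positive parts does not increase the distance there. -/
theorem exists_continuous_approx {ν : ℝ → ℝ} (hν : IsSubdensity ν) {e : ℝ} (he : 0 < e) :
    ∃ f : ℝ → ℝ, IsSubdensity f ∧ Continuous f ∧ HasCompactSupport f ∧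
      ∫ t in Ioi (0 : ℝ), |ν t - f t| ≤ e := by
  obtain ⟨f, hfs, hfe, hfc, hfi⟩ :=
    ((integrable_indicator_iff measurableSet_Ioi).2
      hν.integrable).exists_hasCompactSupport_integral_sub_le he
  have hfi' : Integrable (fun t => max (f t) 0) := hfi.pos_part
  refine ⟨fun t => max (f t) 0, ⟨fun t _ => le_max_right _ _, hfi'.integrableOn⟩,
    hfc.max continuous_const, hfs.comp_left (g := fun x => max x 0) (by simp), ?_⟩
  refine le_trans ?_ hfe
  have hint : Integrable (fun t => ‖(Ioi 0).indicator ν t - f t‖) :=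
    (((integrable_indicator_iff measurableSet_Ioi).2 hν.integrable).sub hfi).norm
  refine le_trans (setIntegral_mono_on (hν.integrable.sub hfi'.integrableOn).abs
    hint.integrableOn measurableSet_Ioi fun t ht => ?_)
    (setIntegral_le_integral hint (ae_of_all _ fun t => norm_nonneg _))
  rw [indicator_of_mem ht, Real.norm_eq_abs]
  have h0 := hν.nonneg t (le_of_lt ht)
  have := abs_max_sub_max_le_abs (ν t) (f t) 0
  rwa [max_eq_left h0] at this

/-- Scaling preserves `L¹` distances, so the error of approximating `ν` is uniform in `r`. -/
theorem IsGame.tendstoUniformly_scale {g : Ω → ℝ} {P : ∀ ω, L ω → M ω → Measure K} {U : Ω → ℝ}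
    [∀ ω, Nonempty (L ω)] [∀ ω, Nonempty (M ω)] [∀ ω l m, IsProbabilityMeasure (P ω l m)]
    (G : IsGame g P) (hU : ∀ ω, U ω ∈ Icc (0 : ℝ) 1)
    (hUm : ∀ n : ℕ, 0 < n → Measurable fun z : K => U (z.1 n))
    (hinv : IsAsymptoticallyInvariant g P U) {ν : ℝ → ℝ} (hν : IsDensity ν) :
    TendstoUniformly (fun r : ℝ => value g P (scale ν r)) U (𝓝[>] 0) := by
  rw [Metric.tendstoUniformly_iff]
  intro e he
  obtain ⟨f, hf, hfc, hfs, hfe⟩ :=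
    exists_continuous_approx hν.isSubdensity (e := min (e / 4) 1) (by positivity)
  have hm : |1 - ∫ t in Ioi (0 : ℝ), f t| ≤ min (e / 4) 1 := by
    have := integral_sub hν.integrable hf.integrable
    rw [hν.integral_eq_one] at this
    rw [← this]
    exact abs_integral_le_integral_abs.trans hfe
  have h2 : (∫ t in Ioi (0 : ℝ), f t) ≤ 2 := by
    linarith [(abs_le.1 hm).1, min_le_right (e / 4) 1]
  filter_upwards [G.eventually_abs_value_scale_sub_le hU hUm hinv hf hfc hfs h2
    (e := e / 4) (by positivity), self_mem_nhdsWithin] with r hr hr0 ω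
  have hd : |value g P (scale ν r) ω - value g P (scale f r) ω| ≤ e / 4 := by
    refine (G.abs_value_sub_le (hν.isSubdensity.scale hr0) (hf.scale hr0) ω).trans ?_
    have : ∀ t, |scale ν r t - scale f r t| = scale (fun t => |ν t - f t|) r t := fun t => by
      simp only [scale]
      rw [← mul_sub, abs_mul, abs_of_pos hr0]
    simp only [this]
    rw [integral_Ioi_scale _ hr0]
    exact hfe.trans (min_le_left _ _)
  have hu : |(∫ t in Ioi (0 : ℝ), f t) * U ω - U ω| ≤ e / 4 := by
    rw [← sub_one_mul, abs_mul, abs_of_nonneg (hU ω).1, abs_sub_comm]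
    exact (mul_le_of_le_one_right (abs_nonneg _) (hU ω).2).trans (hm.trans (min_le_left _ _))
  rw [dist_comm, Real.dist_eq]
  calc _ ≤ _ := abs_sub_le _ (value g P (scale f r) ω) _
    _ ≤ _ := add_le_add hd ((abs_sub_le _ _ _).trans (add_le_add (hr ω) hu))
    _ < e := by linarith

end Invariance

/-! ### From convergence for a self-similar density to asymptotic invariance -/

/-- Densities whose shifts by small times are, after renormalization, scalings of the density
itself. -/
structure IsSelfSimilar (μ : ℝ → ℝ) : Prop where
  isDensity : IsDensity μ
  exists_limit : ∃ a : ℝ, 0 < a ∧ Tendsto μ (𝓝[>] 0) (𝓝 a)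
  exists_shift : ∃ s₁ C : ℝ, 0 < s₁ ∧ ∀ s ∈ Ioo 0 s₁, ∃ q c : ℝ, 0 < c ∧ c ≤ C ∧
    ∀ t, 0 < t → μ (t + s) = q * scale μ c t

section Invariance

variable {Ω : Type*} {K : Set (ℝ≥0 → Ω)} [MeasurableSpace K] {L M : Ω → Type*}
  {g : Ω → ℝ} {P : ∀ ω, L ω → M ω → Measure K} {U : Ω → ℝ}
  [∀ ω, Nonempty (L ω)] [∀ ω, Nonempty (M ω)] [∀ ω l m, IsProbabilityMeasure (P ω l m)]

namespace IsGame

theorem limit_mem_Icc (G : IsGame g P) {ι : Type*} {l : Filter ι} [l.NeBot] {f : ι → ℝ → ℝ}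
    (hf : ∀ᶠ i in l, IsDensity (f i)) (hU : TendstoUniformly (fun i => value g P (f i)) U l)
    (ω : Ω) : U ω ∈ Icc (0 : ℝ) 1 := by
  refine isClosed_Icc.mem_of_tendsto (hU.tendsto_at ω) (hf.mono fun i hi => ?_)
  have := G.value_mem_Icc hi.isSubdensity ω
  rwa [hi.integral_eq_one] at this

theorem measurable_limit (G : IsGame g P) {μ : ℝ → ℝ} (hμ : IsSubdensity μ)
    (hU : TendstoUniformly (fun r : ℝ => value g P (scale μ r)) U (𝓝[>] 0)) {n : ℕ} (hn : 0 < n) :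
    Measurable fun z : K => U (z.1 n) := by
  refine measurable_of_tendsto_metrizable
    (f := fun (k : ℕ) (z : K) => value g P (scale μ (1 / ((k : ℝ) + 1))) (z.1 n))
    (fun k => G.measurable_value (hμ.scale Nat.one_div_pos_of_nat) hn)
    (tendsto_pi_nhds.2 fun z => (hU.tendsto_at (z.1 n)).comp
      (tendsto_nhdsWithin_iff.2 ⟨tendsto_one_div_add_atTop_nhds_zero_nat,
        Eventually.of_forall fun k => mem_Ioi.2 Nat.one_div_pos_of_nat⟩))

/-- With `r = s / h`, the first `h` units of time carry mass about `a * s` under `scale μ r`, where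
`a` is the limit of `μ` at `0`. Hence `δ = a * s`, and `δ₀ = a * s₀` depends only on the behaviour
of `μ` near zero, while large `h` makes the values of the scaled densities close to `U`. -/
theorem isAsymptoticallyInvariant (G : IsGame g P) {μ : ℝ → ℝ} (hμ : IsSelfSimilar μ)
    (hU : ∀ ω, U ω ∈ Icc (0 : ℝ) 1) (hUm : ∀ n : ℕ, 0 < n → Measurable fun z : K => U (z.1 n))
    (hconv : TendstoUniformly (fun r : ℝ => value g P (scale μ r)) U (𝓝[>] 0)) :
    IsAsymptoticallyInvariant g P U := by
  intro ε hε
  obtain ⟨a, ha, hlim⟩ := hμ.exists_limit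
  obtain ⟨s₁, C, hs₁, hshift⟩ := hμ.exists_shift
  obtain ⟨s₂, hs₂, hnear⟩ : ∃ s₂ : ℝ, 0 < s₂ ∧ ∀ t ∈ Ioo 0 s₂, |μ t - a| ≤ ε * a / 2 := by
    have := hlim.eventually (Metric.closedBall_mem_nhds a (show 0 < ε * a / 2 by positivity))
    obtain ⟨s₂, hs₂, h⟩ := mem_nhdsGT_iff_exists_Ioo_subset.1 this
    exact ⟨s₂, hs₂, fun t ht => h ht⟩
  obtain ⟨s₀, hs₀, hs₀₁, hs₀₂⟩ : ∃ s₀ : ℝ, 0 < s₀ ∧ s₀ < s₁ ∧ s₀ < s₂ := by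
    refine ⟨min s₁ s₂ / 2, by positivity, ?_, ?_⟩
    · linarith [min_le_left s₁ s₂]
    · linarith [min_le_right s₁ s₂]
  refine ⟨a * s₀, by positivity, fun η hη => ?_⟩
  obtain ⟨r₀, hr₀, hr₀U⟩ : ∃ r₀ : ℝ, 0 < r₀ ∧ ∀ r ∈ Ioo 0 r₀, ∀ ω,
      |value g P (scale μ r) ω - U ω| ≤ η / 3 := by
    have := Metric.tendstoUniformly_iff.1 hconv (η / 3) (by positivity)
    obtain ⟨r₀, hr₀, h⟩ := mem_nhdsGT_iff_exists_Ioo_subset.1 this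
    refine ⟨r₀, hr₀, fun r hr ω => ?_⟩
    have := h hr ω
    rw [dist_comm, Real.dist_eq] at this
    exact this.le
  -- Both `r` and the tail's parameter `c * r` must fall below `r₀`, whence `max C 1`.
  obtain ⟨H, hH⟩ := exists_nat_gt (s₀ * max C 1 / r₀)
  refine ⟨H, fun h hh hHh => ?_⟩
  have hh0 : (0 : ℝ) < h := Nat.cast_pos.2 hh
  have hpos : ∀ δ : ℝ, 0 < δ → δ ≤ a * s₀ → ∀ ω,
      |U ω - lowerVal P (blend g U h δ) ω| ≤ ε * δ + 2 * (η / 3) := by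
    intro δ hδ hδ₀ ω
    obtain ⟨s, rfl⟩ : ∃ s, δ = a * s := ⟨δ / a, by field_simp⟩
    have hs : 0 < s := pos_of_mul_pos_right hδ ha.le
    have hss₀ : s ≤ s₀ := le_of_mul_le_mul_left hδ₀ ha
    obtain ⟨W, c, hc, hcC, hWc⟩ := hshift s ⟨hs, by linarith⟩
    have hr : 0 < s / h := by positivity
    have hrh : s / h * h = s := by field_simp
    have hsmall : ∀ b, b ≤ max C 1 → b * (s / h) < r₀ := fun b hb => by
      have h1 : s₀ * max C 1 / r₀ < h := hH.trans_le (Nat.cast_le.2 hHh)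
      rw [div_lt_iff₀ hr₀] at h1
      rw [← mul_div_assoc, div_lt_iff₀ hh0]
      calc b * s ≤ max C 1 * s₀ := by gcongr
        _ < _ := by linarith
    set r := s / h with hr_def
    have hsub := hμ.isDensity.isSubdensity
    have hW : W = ∫ t in Ioi (0 : ℝ), μ (t + s) := by
      rw [setIntegral_congr_fun measurableSet_Ioi hWc, integral_const_mul,
        integral_Ioi_scale μ hc, hμ.isDensity.integral_eq_one, mul_one]
    have hW0 : 0 ≤ W := hW ▸ (hsub.comp_add hs.le).integral_nonneg
    have hsplit := hsub.integral_Ioc_add_integral_shift hs.le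
    rw [← hW, hμ.isDensity.integral_eq_one] at hsplit
    have hW1 : W ≤ 1 := by
      have : 0 ≤ ∫ t in Ioc (0 : ℝ) s, μ t :=
        setIntegral_nonneg measurableSet_Ioc fun t ht => hsub.nonneg t ht.1.le
      linarith
    have hWs : |W - (1 - a * s)| ≤ ε * a / 2 * s := by
      have := integral_Ioc_sub_const_le (a := a) (o := ε * a / 2) hs.le
        (hsub.integrable.mono_set Ioc_subset_Ioi_self)
        (fun t ht => hnear t ⟨ht.1, by linarith [ht.2]⟩)
      rwa [show (∫ t in Ioc (0 : ℝ) s, μ t) = 1 - W by linarith, abs_sub_comm,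
        show a * s - (1 - W) = W - (1 - a * s) by ring] at this
    have hval : ∀ ω, value g P (fun t => scale μ r (t + h)) ω = W * value g P (scale μ (c * r)) ω := by
      intro ω
      rw [← value_const_mul g P _ hW0, value_congr g P]
      intro t ht
      rw [scale, mul_add, hrh, hWc _ (by positivity), scale, scale, ← mul_assoc c r t]
      ring
    -- Half of `ε * (a * s)` pays for replacing `μ` by `a` on the head, half for replacing the tail
    -- mass `W` by `1 - a * s`; `η / 3` pays for replacing the tail value by `U`.
    have hF : ∀ z : K, |((∫ t in Ioc (0 : ℝ) h, scale μ r t * g (z.1 t.toNNReal)) +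
        value g P (fun t => scale μ r (t + h)) (z.1 h)) - blend g U h (a * s) z| ≤
        ε * (a * s) + η / 3 := by
      intro z
      have h1 := G.abs_integral_Ioc_sub_le (f := scale μ r) (a := r * a) (o := r * (ε * a / 2))
        (hsub.scale hr).integrable hh0.le (fun t ht => by
          rw [scale, ← mul_sub, abs_mul, abs_of_pos hr]
          refine mul_le_mul_of_nonneg_left (hnear _ ⟨mul_pos hr ht.1, ?_⟩) hr.le
          have := mul_le_mul_of_nonneg_left ht.2 hr.le
          linarith) z
      have h2 : |W * value g P (scale μ (c * r)) (z.1 h) - W * U (z.1 h)| ≤ η / 3 := by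
        rw [← mul_sub, abs_mul, abs_of_nonneg hW0]
        exact (mul_le_of_le_one_left (abs_nonneg _) hW1).trans
          (hr₀U _ ⟨by positivity, hsmall c (hcC.trans (le_max_left _ _))⟩ _)
      have h3 : |W * U (z.1 h) - (1 - a * s) * U (z.1 h)| ≤ ε * a / 2 * s := by
        rw [← sub_mul, abs_mul, abs_of_nonneg (hU _).1]
        exact (mul_le_of_le_one_right (abs_nonneg _) (hU _).2).trans hWs
      rw [hval, blend, show a * s / h = r * a by rw [hr_def]; ring, add_sub_add_comm]
      have h4 := (abs_sub_le _ _ _).trans (add_le_add h2 h3)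
      refine (abs_add_le _ _).trans ((add_le_add h1 h4).trans (le_of_eq ?_))
      rw [show r * (ε * a / 2) * h = r * h * (ε * a / 2) by ring, hrh]
      ring
    have h5 := abs_lowerVal_sub_le (P := P)
      ((G.measurable_integral_Ioc (hsub.scale hr) h).add
        (G.measurable_value ((hsub.scale hr).comp_add hh0.le) hh))
      (G.measurable_blend (hUm h hh) (a * s)) (G.abs_blend_le hU hh hδ.le) hF ω
    have h6 := G.value_eq_lowerVal_shift (hsub.scale hr) hh ω
    have h7 := hr₀U r ⟨hr, by simpa using hsmall 1 (le_max_right _ _)⟩ ω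
    rw [h6, abs_sub_comm] at h7
    have h8 := (abs_sub_le _ _ _).trans (add_le_add h7 h5)
    linarith
  intro δ hδ hδ₀ ω
  -- The weight `δ = 0` corresponds to no positive `s`; it is reached from a small `d > 0`, since
  -- `blend` changes by at most `d`.
  rcases hδ.eq_or_lt with rfl | hδ'
  · obtain ⟨d, hd, hd₀, hdη⟩ : ∃ d : ℝ, 0 < d ∧ d ≤ a * s₀ ∧ ε * d + d ≤ η / 3 := by
      refine ⟨min (a * s₀) (η / 3 / (ε + 1)), by positivity, min_le_left _ _, ?_⟩
      have := (le_div_iff₀ (by positivity)).1 (min_le_right (a * s₀) (η / 3 / (ε + 1)))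
      linarith
    have h1 := hpos d hd hd₀ ω
    have h2 := abs_lowerVal_sub_le (P := P) (G.measurable_blend (hUm h hh) d)
      (G.measurable_blend (hUm h hh) 0) (G.abs_blend_le hU hh le_rfl) (c := d)
      (fun z => by
        have h0 : blend g U h 0 z = U (z.1 h) := by simp [blend]
        rw [h0]
        exact G.abs_blend_sub_le hU hh hd.le z) ω
    have h3 := (abs_sub_le _ _ _).trans (add_le_add h1 h2)
    linarith
  · linarith [hpos δ hδ' hδ₀ ω]

/-- The Tauberian theorem: convergence for a self-similar density implies convergence for every
density. -/
theorem tendstoUniformly_scale_of_isSelfSimilar (G : IsGame g P) {μ : ℝ → ℝ}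
    (hμ : IsSelfSimilar μ)
    (hconv : TendstoUniformly (fun r : ℝ => value g P (scale μ r)) U (𝓝[>] 0))
    {ν : ℝ → ℝ} (hν : IsDensity ν) :
    TendstoUniformly (fun r : ℝ => value g P (scale ν r)) U (𝓝[>] 0) := by
  have hU : ∀ ω, U ω ∈ Icc (0 : ℝ) 1 := G.limit_mem_Icc (f := scale μ)
    (by
      filter_upwards [self_mem_nhdsWithin] with r hr
      have := hμ.isDensity.isSubdensity.scale hr
      exact ⟨this.nonneg, this.integrable,
        (integral_Ioi_scale μ hr).trans hμ.isDensity.integral_eq_one⟩) hconv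
  have hUm := fun n (hn : 0 < n) => G.measurable_limit hμ.isDensity.isSubdensity hconv hn
  exact G.tendstoUniformly_scale hU hUm (G.isAsymptoticallyInvariant hμ hU hUm hconv) hν

end IsGame

end Invariance

/-! ### Uniform, exponential and power densities -/

/-- Memorylessness: a shift is a multiple of the density itself, so `c = 1`. -/
theorem isSelfSimilar_expDensity_one : IsSelfSimilar (expDensity 1) := by
  have he : expDensity 1 = fun t => Real.exp (-t) := by funext t; simp [expDensity]
  rw [he]
  refine ⟨⟨fun t _ => (Real.exp_pos _).le, integrableOn_exp_neg_Ioi 0, integral_exp_neg_Ioi_zero⟩,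
    ⟨1, one_pos, ?_⟩, ⟨1, 1, one_pos, fun s _ => ⟨Real.exp (-s), 1, one_pos, le_rfl, fun t _ => ?_⟩⟩⟩
  · have : Tendsto (fun t : ℝ => Real.exp (-t)) (𝓝 0) (𝓝 (Real.exp (-0))) :=
      (Real.continuous_exp.comp continuous_neg).tendsto 0
    rw [neg_zero, Real.exp_zero] at this
    exact this.mono_left nhdsWithin_le_nhds
  · simp only [scale, one_mul]
    rw [← Real.exp_add]
    congr 1
    ring

theorem scale_expDensity_one (r : ℝ) : scale (expDensity 1) r = expDensity r := by
  funext t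
  simp [scale, expDensity]

theorem piecewiseContinuous_of_continuous {f : ℝ → ℝ} (hf : Continuous f) :
    PiecewiseContinuous f := by
  refine ⟨fun a b _ => ?_, fun t _ => ⟨⟨f t, ?_⟩, ⟨f t, ?_⟩⟩⟩
  · simp [hf.continuousAt]
  · exact hf.continuousAt.mono_left nhdsWithin_le_nhds
  · exact hf.continuousAt.mono_left nhdsWithin_le_nhds

/-- What remains of `[0, 1]` after time `s` is an interval of length `1 - s`; restricting to `s < 1
/ 2` keeps the factor `1 / (1 - s)` below 2. -/
theorem isSelfSimilar_uniformDensity_one : IsSelfSimilar (uniformDensity 1) := by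
  have hint : (Ioi (0 : ℝ)) ∩ Icc 0 1 = Ioc 0 1 := by
    ext t
    simp only [mem_inter_iff, mem_Ioi, mem_Icc, mem_Ioc]
    constructor
    · rintro ⟨h1, h2⟩; exact ⟨h1, h2.2⟩
    · rintro ⟨h1, h2⟩; exact ⟨h1, h1.le, h2⟩
  refine ⟨⟨fun t _ => indicator_nonneg (fun _ _ => by norm_num) t, ?_, ?_⟩, ⟨1, one_pos, ?_⟩,
    ⟨1 / 2, 2, by norm_num, fun s hs => ⟨1 - s, 1 / (1 - s), ?_, ?_, fun t ht => ?_⟩⟩⟩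
  · exact ((integrable_indicator_iff measurableSet_Icc).2
      (continuous_const.integrableOn_Icc)).integrableOn
  · rw [uniformDensity, setIntegral_indicator measurableSet_Icc, hint]
    simp
  · refine tendsto_const_nhds.congr' ?_
    filter_upwards [Ioo_mem_nhdsGT (one_pos (α := ℝ))] with t ht
    rw [uniformDensity, indicator_of_mem (mem_Icc.2 ⟨ht.1.le, ht.2.le⟩), div_one]
  · have := hs.2
    exact one_div_pos.2 (by linarith)
  · rw [div_le_iff₀ (by linarith [hs.2])]
    linarith [hs.2]
  · have h1 : 0 < 1 - s := by linarith [hs.2]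
    have hmem : t + s ∈ Icc (0 : ℝ) 1 ↔ 1 / (1 - s) * t ∈ Icc (0 : ℝ) 1 := by
      have h2 : 0 ≤ 1 / (1 - s) * t := by positivity
      have h3 : 0 ≤ t + s := by linarith [hs.1]
      simp only [mem_Icc, h2, h3, true_and]
      rw [one_div_mul_eq_div, div_le_one h1]
      constructor <;> intro h <;> linarith
    unfold scale uniformDensity
    by_cases ht' : t + s ∈ Icc (0 : ℝ) 1
    · rw [indicator_of_mem ht', indicator_of_mem (hmem.1 ht')]
      field_simp
    · rw [indicator_of_notMem ht', indicator_of_notMem (fun h => ht' (hmem.2 h))]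
      simp

theorem scale_uniformDensity_one {T : ℝ} (hT : 0 < T) :
    scale (uniformDensity 1) (1 / T) = uniformDensity T := by
  funext t
  have hmem : t ∈ Icc 0 T ↔ 1 / T * t ∈ Icc (0 : ℝ) 1 := by
    rw [one_div_mul_eq_div, mem_Icc, mem_Icc, div_le_one hT, le_div_iff₀ hT, zero_mul]
  unfold scale uniformDensity
  by_cases ht : t ∈ Icc 0 T
  · rw [indicator_of_mem ht, indicator_of_mem (hmem.1 ht)]
    simp
  · rw [indicator_of_notMem ht, indicator_of_notMem (fun h => ht (hmem.2 h))]
    simp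

/-- The identity `1 + t + s = (1 + s) * (1 + t / (1 + s))` turns shifts into scalings. -/
theorem isSelfSimilar_const_mul_rpow {A γ : ℝ} (hA : 0 < A)
    (hd : IsDensity fun t => A * (1 + t) ^ (-γ)) : IsSelfSimilar fun t => A * (1 + t) ^ (-γ) := by
  refine ⟨hd, ⟨A, hA, ?_⟩, ⟨1, 1, one_pos, fun s hs =>
    ⟨(1 + s) ^ (-γ) * (1 + s), 1 / (1 + s), ?_, ?_, fun t ht => ?_⟩⟩⟩
  · have hc : ContinuousAt (fun t : ℝ => A * (1 + t) ^ (-γ)) 0 :=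
      continuousAt_const.mul ((continuousAt_const.add continuousAt_id).rpow_const
        (Or.inl (by simp)))
    have := hc.tendsto
    simp only [add_zero, Real.one_rpow, mul_one] at this
    exact this.mono_left nhdsWithin_le_nhds
  · have := hs.1
    positivity
  · rw [div_le_one (by linarith [hs.1])]
    linarith [hs.1]
  · have h1 : 0 < 1 + s := by linarith [hs.1]
    simp only [scale]
    rw [show 1 + (t + s) = (1 + s) * (1 + 1 / (1 + s) * t) by field_simp; ring,
      Real.mul_rpow h1.le (by positivity)]
    field_simp

/-- The shifts of a power density are the scalings of a normalized power density. -/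
theorem IsPowerDensity.exists_shift_eq_scale {ϱ : ℝ → ℝ} (hϱ : IsPowerDensity ϱ) :
    ∃ (μ : ℝ → ℝ) (α β : ℝ), IsSelfSimilar μ ∧ 0 < α ∧ 0 < β ∧
      ∀ T t : ℝ, 0 < T → 0 < t → shift ϱ T t = scale μ (β / (α + β * T)) t := by
  obtain ⟨hd, α, β, γ, hα, hβ, hγ, hϱ⟩ := hϱ
  have hr : 0 < α / β := by positivity
  set A := α / β * α ^ (-γ) with hA_def
  have hA : 0 < A := by positivity
  have hscale : ∀ t : ℝ, 0 ≤ t → scale ϱ (α / β) t = A * (1 + t) ^ (-γ) := fun t ht => by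
    rw [scale, hϱ _ (by positivity), one_div, ← Real.rpow_neg (by positivity),
      show α + β * (α / β * t) = α * (1 + t) by field_simp, Real.mul_rpow hα.le (by positivity),
      hA_def, mul_assoc]
  have hsub := hd.isSubdensity.scale hr
  have hμ : IsDensity fun t => A * (1 + t) ^ (-γ) :=
    ⟨fun t ht => by positivity,
      hsub.integrable.congr_fun (fun t ht => hscale t (le_of_lt ht)) measurableSet_Ioi, by
        rw [← setIntegral_congr_fun measurableSet_Ioi fun t ht => hscale t (le_of_lt ht),
          integral_Ioi_scale ϱ hr, hd.integral_eq_one]⟩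
  refine ⟨_, α, β, isSelfSimilar_const_mul_rpow hA hμ, hα, hβ, fun T t hT ht => ?_⟩
  have hT' : 0 < α + β * T := by positivity
  have hr' : 0 < β / (α + β * T) := by positivity
  obtain ⟨X, hX, hXt⟩ : ∃ X : ℝ, X ≠ 0 ∧ ∀ t, 0 < t →
      ϱ (t + T) = X * scale (fun t => A * (1 + t) ^ (-γ)) (β / (α + β * T)) t := by
    refine ⟨(α + β * T) ^ (-γ) / (A * (β / (α + β * T))), by positivity, fun t ht => ?_⟩
    rw [hϱ _ (by positivity), one_div, ← Real.rpow_neg (by positivity), scale,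
      show α + β * (t + T) = (α + β * T) * (1 + β / (α + β * T) * t) by field_simp; ring,
      Real.mul_rpow hT'.le (by positivity)]
    field_simp
  -- Integrating the proportionality identifies its constant with the tail mass, so the
  -- normalization in `shift` cancels it.
  have hI : ∫ s in Ioi T, ϱ s = X := by
    have := integral_Ioi_comp_add_right ϱ 0 T
    rw [zero_add] at this
    rw [← this, setIntegral_congr_fun measurableSet_Ioi hXt, integral_const_mul,
      integral_Ioi_scale _ hr', hμ.integral_eq_one, mul_one]
  rw [shift, hI, hXt t ht, mul_div_cancel_left₀ _ hX]

/-- A witness is needed to pass from all power densities to some power density. -/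
theorem exists_isPowerDensity : ∃ ϱ : ℝ → ℝ, IsPowerDensity ϱ := by
  have hd : IsDensity fun t => (t + 1) ^ (-2 : ℝ) := by
    refine ⟨fun t ht => by positivity, ?_, ?_⟩
    · rw [integrableOn_Ioi_comp_add_right (f := fun t => t ^ (-2 : ℝ)), zero_add]
      exact integrableOn_Ioi_rpow_of_lt (by norm_num) one_pos
    · rw [integral_Ioi_comp_add_right (fun t => t ^ (-2 : ℝ)), zero_add,
        integral_Ioi_rpow_of_lt (by norm_num) one_pos]
      norm_num
  refine ⟨_, hd, 1, 1, 2, one_pos, one_pos, two_pos, fun t ht => ?_⟩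
  rw [Real.rpow_neg (by positivity), one_div, one_mul, add_comm]

/-! ### Changes of the parameter of convergence -/

theorem tendstoUniformly_comp {ι ι' X : Type*} {l : Filter ι} {l' : Filter ι'} {F : ι → X → ℝ}
    {F' : ι' → X → ℝ} {U : X → ℝ} (hF : TendstoUniformly F U l) {p : ι' → ι} (hp : Tendsto p l' l)
    (h : ∀ᶠ i in l', F (p i) = F' i) : TendstoUniformly F' U l' := fun u hu => by
  filter_upwards [hp.eventually (hF u hu), h] with i hi he
  rw [← he]
  exact hi

theorem tendsto_div_add_mul_atTop {α β : ℝ} (hα : 0 ≤ α) (hβ : 0 < β) :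
    Tendsto (fun T : ℝ => β / (α + β * T)) atTop (𝓝[>] 0) := by
  refine tendsto_nhdsWithin_iff.2 ⟨?_, ?_⟩
  · exact (tendsto_atTop_add_const_left _ α (tendsto_id.const_mul_atTop hβ)).const_div_atTop β
  · filter_upwards [eventually_gt_atTop 0] with T hT
    exact div_pos hβ (by positivity)

theorem tendsto_one_div_sub_atTop (c : ℝ) :
    Tendsto (fun r : ℝ => 1 / r - c) (𝓝[>] 0) atTop := by
  simpa [sub_eq_add_neg] using tendsto_atTop_add_const_right _ (-c) tendsto_inv_nhdsGT_zero

/-! ### Equivalence of the conditions -/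

section Conditions

variable {Ω : Type*} {K : Set (ℝ≥0 → Ω)} [MeasurableSpace K] {L M : Ω → Type*}
  {g : Ω → ℝ} {P : ∀ ω, L ω → M ω → Measure K} {U : Ω → ℝ}

theorem condE_iff :
    CondE g P U ↔ TendstoUniformly (fun r : ℝ => value g P (scale (expDensity 1) r)) U (𝓝[>] 0) := by
  simp only [CondE, scale_expDensity_one]

theorem condU_iff :
    CondU g P U ↔
      TendstoUniformly (fun r : ℝ => value g P (scale (uniformDensity 1) r)) U (𝓝[>] 0) := by
  constructor <;> intro h
  · refine tendstoUniformly_comp h (by simpa using tendsto_one_div_sub_atTop 0) ?_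
    filter_upwards [self_mem_nhdsWithin] with r hr
    rw [← one_div, ← scale_uniformDensity_one (one_div_pos.2 hr), one_div_one_div]
  · refine tendstoUniformly_comp h
      (by simpa using tendsto_div_add_mul_atTop le_rfl (one_pos (α := ℝ))) ?_
    filter_upwards [eventually_gt_atTop 0] with T hT
    rw [← scale_uniformDensity_one hT, one_div]

/-- The map `T ↦ β / (α + β * T)` has inverse `r ↦ 1 / r - α / β` and matches `T → ∞` with `r → 0+`.
-/
theorem tendstoUniformly_shift_iff {ϱ μ : ℝ → ℝ} {α β : ℝ} (hα : 0 < α) (hβ : 0 < β)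
    (h : ∀ T t : ℝ, 0 < T → 0 < t → shift ϱ T t = scale μ (β / (α + β * T)) t) :
    TendstoUniformly (fun T : ℝ => value g P (shift ϱ T)) U atTop ↔
      TendstoUniformly (fun r : ℝ => value g P (scale μ r)) U (𝓝[>] 0) := by
  constructor <;> intro hc
  · have hp := tendsto_one_div_sub_atTop (α / β)
    refine tendstoUniformly_comp hc hp ?_
    filter_upwards [self_mem_nhdsWithin, hp.eventually_gt_atTop 0] with r hr hr'
    refine value_congr g P fun t ht => ?_
    have he : β / (α + β * (1 / r - α / β)) = r := by
      rw [mul_sub, mul_div_cancel₀ α hβ.ne', add_sub_cancel, mul_one_div, div_div_cancel₀ hβ.ne']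
    rw [h _ t hr' ht, he]
  · refine tendstoUniformly_comp hc (tendsto_div_add_mul_atTop hα.le hβ) ?_
    filter_upwards [eventually_gt_atTop 0] with T hT
    exact value_congr g P fun t ht => (h T t hT ht).symm

variable [∀ ω, Nonempty (L ω)] [∀ ω, Nonempty (M ω)] [∀ ω l m, IsProbabilityMeasure (P ω l m)]

/-- The sixth condition, convergence for all densities without piecewise continuity, is the hub of
the equivalences. -/
theorem IsGame.tfae (G : IsGame g P) :
    List.TFAE [CondC g P U, CondU g P U, CondE g P U, CondP g P U, CondQ g P U,
      ∀ ν : ℝ → ℝ, IsDensity ν →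
        TendstoUniformly (fun r : ℝ => value g P (scale ν r)) U (𝓝[>] 0)] := by
  tfae_have 6 → 1 := fun h μ hμ _ => h μ hμ
  tfae_have 1 → 3 := fun h => condE_iff.2 (h _ isSelfSimilar_expDensity_one.isDensity
    (piecewiseContinuous_of_continuous (by unfold expDensity; fun_prop)))
  tfae_have 3 → 6 := fun h _ hν =>
    G.tendstoUniformly_scale_of_isSelfSimilar isSelfSimilar_expDensity_one (condE_iff.1 h) hν
  tfae_have 6 → 2 := fun h => condU_iff.2 (h _ isSelfSimilar_uniformDensity_one.isDensity)
  tfae_have 2 → 6 := fun h _ hν =>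
    G.tendstoUniformly_scale_of_isSelfSimilar isSelfSimilar_uniformDensity_one (condU_iff.1 h) hν
  tfae_have 6 → 5 := fun h ϱ hϱ => by
    obtain ⟨μ, α, β, hμ, hα, hβ, hs⟩ := hϱ.exists_shift_eq_scale
    exact (tendstoUniformly_shift_iff hα hβ hs).2 (h μ hμ.isDensity)
  tfae_have 5 → 4 := fun h => exists_isPowerDensity.imp fun ϱ hϱ => ⟨hϱ, h ϱ hϱ⟩
  tfae_have 4 → 6 := fun ⟨ϱ, hϱ, h⟩ ν hν => by
    obtain ⟨μ, α, β, hμ, hα, hβ, hs⟩ := hϱ.exists_shift_eq_scale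
    exact G.tendstoUniformly_scale_of_isSelfSimilar hμ
      ((tendstoUniformly_shift_iff hα hβ hs).1 h) hν
  tfae_finish

theorem IsGame.mem_Icc_of_condE (G : IsGame g P) (h : CondE g P U) (ω : Ω) :
    U ω ∈ Icc (0 : ℝ) 1 := by
  refine G.limit_mem_Icc (f := expDensity) ?_ h ω
  filter_upwards [self_mem_nhdsWithin] with r hr
  have hd := isSelfSimilar_expDensity_one.isDensity
  have hs := hd.isSubdensity.scale hr
  rw [← scale_expDensity_one]
  exact ⟨hs.nonneg, hs.integrable, (integral_Ioi_scale _ hr).trans hd.integral_eq_one⟩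

end Conditions

end StochTauber

theorem mainTheorem7 {Ω : Type*} [Nonempty Ω]
    (K : Set (ℝ≥0 → Ω)) (hK : K.Nonempty)
    (g : Ω → ℝ) (hg : ∀ ω, g ω ∈ Set.Icc (0 : ℝ) 1)
    -- every superposition of `g` with a process is Lebesgue measurable on the half-line
    (hgK : ∀ z ∈ K, AEMeasurable (fun t : ℝ => g (z t.toNNReal)) (volume.restrict (Set.Ioi 0)))
    [MeasurableSpace K]
    (hpay : ∀ ϱ : ℝ → ℝ, StochTauber.IsDensity ϱ →
      Measurable fun z : K => StochTauber.payoff g ϱ z)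
    (L M : Ω → Type*) [∀ ω, Nonempty (L ω)] [∀ ω, Nonempty (M ω)]
    (P : ∀ ω, L ω → M ω → Measure K) [∀ ω l m, IsProbabilityMeasure (P ω l m)]
    (hDPP :
      (∀ T : ℝ≥0, 0 < T →
        StochTauber.MeasurableValueAt g P T ∧ StochTauber.DPPAt g P T) ∨
      (StochTauber.PiecewiseConstant K ∧
        ∀ n : ℕ, 0 < n →
          StochTauber.MeasurableValueAt g P (n : ℝ≥0) ∧ StochTauber.DPPAt g P (n : ℝ≥0))) :
    (∀ U : Ω → ℝ, (∀ ω, U ω ∈ Set.Icc (0 : ℝ) 1) →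
      List.TFAE [StochTauber.CondC g P U, StochTauber.CondU g P U, StochTauber.CondE g P U,
        StochTauber.CondP g P U, StochTauber.CondQ g P U]) ∧
    -- if one of the uniform limits exists, then all of them exist and coincide
    (∀ W : Ω → ℝ,
      (StochTauber.CondU g P W ∨ StochTauber.CondE g P W ∨ StochTauber.CondP g P W) →
        (∀ ω, W ω ∈ Set.Icc (0 : ℝ) 1) ∧
          StochTauber.CondU g P W ∧ StochTauber.CondE g P W ∧
          StochTauber.CondQ g P W ∧ StochTauber.CondC g P W) := by
  -- Either alternative supplies the dynamic programming identity at positive integer times, and the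
  -- block lengths `h` are always integers.
  have G : StochTauber.IsGame g P := by
    refine ⟨hg, hgK, hpay, fun n hn => ?_, fun n hn => ?_⟩
    · exact hDPP.elim (fun h => (h n (Nat.cast_pos.2 hn)).1) fun h => (h.2 n hn).1
    · exact hDPP.elim (fun h => (h n (Nat.cast_pos.2 hn)).2) fun h => (h.2 n hn).2
  refine ⟨fun U _ => ?_, fun W hW => ?_⟩
  · have h := G.tfae (U := U)
    tfae_have 1 ↔ 3 := h.out 0 2
    tfae_have 2 ↔ 3 := h.out 1 2
    tfae_have 4 ↔ 3 := h.out 3 2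
    tfae_have 5 ↔ 3 := h.out 4 2
    tfae_finish
  · have h := G.tfae (U := W)
    have hE : StochTauber.CondE g P W := by
      rcases hW with hW | hW | hW
      · exact (h.out 1 2).1 hW
      · exact hW
      · exact (h.out 3 2).1 hW
    exact ⟨G.mem_Icc_of_condE hE, (h.out 2 1).1 hE, hE, (h.out 2 4).1 hE, (h.out 2 0).1 hE⟩
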